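/- Let $N$ be a positive integer and let $f\in\mathbb{Z}[X_1^{\pm1},\ldots,X_N^{\pm1}]$ be a non-zero Laurent polynomial. For a finite subgroup $\Lambda$ of $(\overline{\mathbb{Q}}^{\,*})^N$, write $\|\Lambda\|$ for its cardinality and put $$W_f(\Lambda)=\prod_{\substack{\boldsymbol\zeta\in\Lambda\\ f(\boldsymbol\zeta)\neq 0}} f(\boldsymbol\zeta),$$ which is a (rational) integer. For a prime $p$, let $\mathrm{RA}_f(p)$ be the set of finite subgroups $\Lambda$ of $(\overline{\mathbb{Q}}^{\,*})^N$ such that $p\mid W_f(\Lambda)$ and $p\nmid W_f(\Lambda')$ for every proper subgroup $\Lambda'\subsetneq\Lambda$. For real $\theta>0$, let $$\mathcal{P}_f(\theta)=\bigl\{p \text{ prime} : \text{there exists } \Lambda\in\mathrm{RA}_f(p) \text{ with } \|\Lambda\|\le p^\theta\bigr\}.$$ Then the upper logarithmic Dirichlet density of $\mathcal{P}_f(\theta)$ is at most $(N+1)\theta$, that is, $$\limsup_{s\to1^+}\;(s-1)\sum_{p\in\mathcal{P}_f(\theta)}\frac{\log p}{p^s}\;\le\;(N+1)\theta .$$ 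-/

import Mathlib

noncomputable section

namespace DDSeq

open Filter Topology

/-- The ring `ℤ[X₁^{±1}, …, X_N^{±1}]` of Laurent polynomials in `N` variables over `ℤ`,
i.e. the group ring of the additive group `ℤ^N` (the exponent vectors). -/
abbrev LaurentPoly (N : ℕ) : Type := AddMonoidAlgebra ℤ (Fin N → ℤ)

/-- The algebraic (equivalently, separable) closure of `ℚ`. -/
abbrev QBar : Type := AlgebraicClosure ℚ

/-- The group `𝔾_m^N(ℚ̄) = (ℚ̄ˣ)^N` of points of the `N`-dimensional torus. -/
abbrev Torus (N : ℕ) : Type := Fin N → QBarˣ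

/-- The value `f(ζ) = ∑_m a_m(f) ζ₁^{m₁} ⋯ ζ_N^{m_N}` of a Laurent polynomial at a point of
the torus. -/
def eval {N : ℕ} (f : LaurentPoly N) (ζ : Torus N) : QBar :=
  f.coeff.sum fun m a => (a : QBar) * ((∏ i, ζ i ^ m i : QBarˣ) : QBar)

/-- The finite subgroups of `𝔾_m^N(ℚ̄)`, ordered by inclusion. -/
abbrev FinSubgroup (N : ℕ) : Type := {Λ : Subgroup (Torus N) // (Λ : Set (Torus N)).Finite}

/-- The cardinality `‖Λ‖` of a finite subgroup. -/
def FinSubgroup.size {N : ℕ} (Λ : FinSubgroup N) : ℕ := Nat.card Λ.1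

open Classical in
/-- The product of `f(ζ)` over all `ζ ∈ Λ` with `f(ζ) ≠ 0`, as an element of `ℚ̄`. -/
def prodValue {N : ℕ} (f : LaurentPoly N) (Λ : FinSubgroup N) : QBar :=
  ∏ ζ ∈ Λ.2.toFinset with eval f ζ ≠ 0, eval f ζ

theorem isIntegral_eval {N : ℕ} (f : LaurentPoly N) (Λ : FinSubgroup N) {ζ : Torus N}
    (hζ : ζ ∈ Λ.1) : IsIntegral ℤ (eval f ζ) := by
  have : Finite Λ.1 := Λ.2
  have hn : 0 < Nat.card Λ.1 := Nat.card_pos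
  have h1 : ζ ^ Nat.card Λ.1 = 1 := by
    have := pow_card_eq_one' (x := (⟨ζ, hζ⟩ : Λ.1))
    exact congrArg Subtype.val this
  unfold eval
  refine IsIntegral.sum _ fun m _ => ?_
  refine IsIntegral.mul (isIntegral_algebraMap (R := ℤ) (A := QBar)) ?_
  refine IsIntegral.of_pow hn ?_
  have h2 : (∏ i, ζ i ^ m i) ^ Nat.card Λ.1 = 1 := by
    rw [← Finset.prod_pow]
    refine Finset.prod_eq_one fun i _ => ?_
    rw [← zpow_natCast, ← zpow_mul, mul_comm, zpow_mul, zpow_natCast]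
    have := congrFun h1 i
    simp only [Pi.pow_apply, Pi.one_apply] at this
    rw [this, one_zpow]
  rw [← Units.val_pow_eq_pow_val, h2]
  exact isIntegral_one

theorem map_eval {N : ℕ} (f : LaurentPoly N) (σ : QBar ≃ₐ[ℚ] QBar) (ζ : Torus N) :
    σ (eval f ζ) = eval f (fun i => Units.map (σ : QBar →* QBar) (ζ i)) := by
  unfold eval Finsupp.sum
  rw [map_sum]
  refine Finset.sum_congr rfl fun m _ => ?_
  simp only [map_mul, map_intCast, Units.coe_prod, map_prod, Units.val_zpow_eq_zpow_val,
    map_zpow₀, Units.coe_map]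
  rfl

theorem galois_mem {N : ℕ} (Λ : FinSubgroup N) (σ : QBar ≃ₐ[ℚ] QBar) {ζ : Torus N}
    (hζ : ζ ∈ Λ.1) : (fun i => Units.map (σ : QBar →* QBar) (ζ i)) ∈ Λ.1 := by
  have : Finite Λ.1 := Λ.2
  have hn : NeZero (Nat.card Λ.1) := ⟨Nat.card_pos.ne'⟩
  have h1 : ζ ^ Nat.card Λ.1 = 1 :=
    congrArg Subtype.val (pow_card_eq_one' (x := (⟨ζ, hζ⟩ : Λ.1)))
  obtain ⟨k, hk⟩ := MonoidHom.map_cyclic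
    (restrictRootsOfUnity (σ : QBar →+* QBar) (Nat.card Λ.1))
  have : (fun i => Units.map (σ : QBar →* QBar) (ζ i)) = ζ ^ k := by
    funext i
    have hi : ζ i ∈ rootsOfUnity (Nat.card Λ.1) QBar := by
      rw [mem_rootsOfUnity]
      exact congrFun h1 i
    have h3 := hk ⟨ζ i, hi⟩
    have h4 := congrArg (fun u : rootsOfUnity (Nat.card Λ.1) QBar => ((u : QBarˣ) : QBar)) h3
    apply Units.ext
    simpa using h4
  rw [this]
  exact Λ.1.zpow_mem hζ k

theorem map_prodValue {N : ℕ} (f : LaurentPoly N) (Λ : FinSubgroup N)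
    (σ : QBar ≃ₐ[ℚ] QBar) : σ (prodValue f Λ) = prodValue f Λ := by
  classical
  unfold prodValue
  rw [map_prod]
  have hinj : Function.Injective
      (fun (ζ : Torus N) (i : Fin N) => Units.map (σ : QBar →* QBar) (ζ i)) := by
    intro a b hab
    funext i
    have := congrArg (Units.val) (congrFun hab i)
    exact Units.ext (σ.injective this)
  have hmaps : ∀ ζ ∈ Λ.2.toFinset.filter (fun ζ => eval f ζ ≠ 0),
      (fun i => Units.map (σ : QBar →* QBar) (ζ i)) ∈
        Λ.2.toFinset.filter (fun ζ => eval f ζ ≠ 0) := by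
    intro ζ hζ
    simp only [Finset.mem_filter, Set.Finite.mem_toFinset, SetLike.mem_coe] at hζ ⊢
    refine ⟨galois_mem Λ σ hζ.1, ?_⟩
    rw [← map_eval]
    simpa using hζ.2
  refine Finset.prod_bij (fun ζ _ => fun i => Units.map (σ : QBar →* QBar) (ζ i)) hmaps
    (fun a _ b _ h => hinj h) ?_ (fun a _ => map_eval f σ a)
  intro b hb
  obtain ⟨a, ha, hab⟩ := Finset.surj_on_of_inj_on_of_card_le
    (fun ζ (_ : ζ ∈ Λ.2.toFinset.filter (fun ζ => eval f ζ ≠ 0)) =>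
      (fun i => Units.map (σ : QBar →* QBar) (ζ i))) hmaps (fun a b _ _ h => hinj h) le_rfl b hb
  exact ⟨a, ha, hab.symm⟩

/-- The product over `Λ` is a rational integer. -/
theorem exists_int_eq_prodValue {N : ℕ} (f : LaurentPoly N) (Λ : FinSubgroup N) :
    ∃ n : ℤ, (n : QBar) = prodValue f Λ := by
  classical
  have : IsGalois ℚ QBar := by
    have h := @IsAlgClosure.isGalois ℚ QBar _ _ (AlgebraicClosure.instAlgebra ℚ) inferInstance _
    convert h
    exact Subsingleton.elim _ _
  obtain ⟨q, hq⟩ := (InfiniteGalois.mem_range_algebraMap_iff_fixed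
    (k := ℚ) (prodValue f Λ)).2 (map_prodValue f Λ)
  have hint : IsIntegral ℤ (prodValue f Λ) := by
    unfold prodValue
    refine IsIntegral.prod _ fun ζ hζ => ?_
    simp only [Finset.mem_filter, Set.Finite.mem_toFinset, SetLike.mem_coe] at hζ
    exact isIntegral_eval f Λ hζ.1
  rw [← hq] at hint
  have hq' : IsIntegral ℤ q :=
    (isIntegral_algebraMap_iff (algebraMap ℚ QBar).injective).1 hint
  obtain ⟨n, hn⟩ := IsIntegrallyClosed.isIntegral_iff.1 hq'
  refine ⟨n, ?_⟩
  rw [← hq, ← hn]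
  simp

/-- The divisor divisibility sequence attached to `f`: the map sending a finite subgroup `Λ`
of `𝔾_m^N(ℚ̄)` to the integer `W_f(Λ) = ∏_{ζ ∈ Λ, f(ζ) ≠ 0} f(ζ)`. -/
def W {N : ℕ} (f : LaurentPoly N) (Λ : FinSubgroup N) : ℤ :=
  (exists_int_eq_prodValue f Λ).choose

theorem W_spec {N : ℕ} (f : LaurentPoly N) (Λ : FinSubgroup N) :
    (W f Λ : QBar) = prodValue f Λ :=
  (exists_int_eq_prodValue f Λ).choose_spec

/-- `RA_f(p)`: the set of ranks of apparition for `p`, i.e. of the finite subgroups `Λ` with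
`p ∣ W_f(Λ)` and `p ∤ W_f(Λ')` for every proper subgroup `Λ'` of `Λ`. -/
def RA {N : ℕ} (f : LaurentPoly N) (p : Nat.Primes) : Set (FinSubgroup N) :=
  {Λ | ((p : ℕ) : ℤ) ∣ W f Λ ∧ ∀ Λ' : FinSubgroup N, Λ' < Λ → ¬ ((p : ℕ) : ℤ) ∣ W f Λ'}

/-- `P_f(θ)`: the primes `p` for which some `Λ ∈ RA_f(p)` has `‖Λ‖ ≤ p^θ`. -/
def smallRankPrimes {N : ℕ} (f : LaurentPoly N) (θ : ℝ) : Set Nat.Primes :=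
  {p | ∃ Λ ∈ RA f p, (Λ.size : ℝ) ≤ ((p : ℕ) : ℝ) ^ θ}

/-- The upper logarithmic Dirichlet density
`limsup_{s → 1⁺} (s - 1) ∑_{p ∈ P} (log p) / p^s` of a set `P` of primes. All terms are
nonnegative, and the sum and the limsup are taken in `[0, ∞]`. -/
def upperLogDirichletDensity (P : Set Nat.Primes) : ENNReal :=
  limsup (fun s : ℝ => ENNReal.ofReal (s - 1) *
      ∑' p : P, ENNReal.ofReal (Real.log ((p : Nat.Primes) : ℕ) / (((p : Nat.Primes) : ℕ) : ℝ) ^ s))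
    (𝓝[>] (1 : ℝ))

end DDSeq

end

/-!
The reason for the bound is that a small rank of apparition forces `p` to divide one of a short
list of integers of controlled size, and that the resulting sum over primes even converges.

If `p ∣ W_f(Λ)` and `n = ‖Λ‖`, then `Λ` lies in the full torsion group `μ_n^N`, and `W_f` is
monotone for divisibility (`W_dvd_W_of_le`), so that `p` divides `U_n = W_f(μ_n^N)`. This is a
product of at most `n ^ N` values of `f` at torsion points, each of absolute value at most the sum
of the absolute values of the coefficients of `f` in every complex embedding; hence
`log |U_n| ≤ C n ^ N` (`exists_log_natAbs_W_torsion_le`). If moreover `n ≤ p ^ θ`, then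
`1 / p ≤ n ^ (-1 / θ)`, and since `∑_{p ∣ m} log p ≤ log m`, summing over `n` gives
`∑_{p ∈ P_f(θ)} log p / p ≤ ∑_n n ^ (-1 / θ) log |U_n| ≤ C ∑_n n ^ (N - 1 / θ)`.

When `(N + 1) θ < 1` the last series converges, and a set of primes with convergent
`∑ log p / p` has density zero (`upperLogDirichletDensity_eq_zero`). When `(N + 1) θ ≥ 1` the
bound follows from the fact that no set of primes has density more than one
(`upperLogDirichletDensity_le_one`), which comes from the simple pole of `-ζ'/ζ` at `1`.
-/

open Filter Topology

namespace DDSeq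

/-! ### Dirichlet densities of sets of primes -/

/-- The Dirichlet series `-ζ'/ζ` of the von Mangoldt function has residue `1` at `s = 1`. -/
theorem tendsto_sub_one_mul_tsum_vonMangoldt :
    Tendsto (fun s : ℝ => (s - 1) * ∑' n : ℕ, ArithmeticFunction.vonMangoldt n / (n : ℝ) ^ s)
      (𝓝[>] 1) (𝓝 1) := by
  open ArithmeticFunction.vonMangoldt in
  -- Modulo `1` there is a single residue class, so the results on primes in arithmetic
  -- progressions apply to the full von Mangoldt function.
  have hres : ∀ n : ℕ, residueClass (1 : ZMod 1) n = ArithmeticFunction.vonMangoldt n :=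
    fun n => Set.indicator_of_mem (s := {n : ℕ | (n : ZMod 1) = 1}) (Subsingleton.elim _ _) _
  have H {x : ℝ} (hx : 1 < x) :
      ∑' n : ℕ, ArithmeticFunction.vonMangoldt n / (n : ℝ) ^ x =
        (LFunctionResidueClassAux (1 : ZMod 1) x).re + 1 / (x - 1) := by
    apply Complex.ofReal_injective
    have h1 := eqOn_LFunctionResidueClassAux (isUnit_one (M := ZMod 1))
      (show (x : ℂ) ∈ {s : ℂ | 1 < s.re} by simpa using hx)
    rw [Complex.ofReal_add, ← LFunctionResidueClassAux_real isUnit_one hx, h1]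
    simp only [Complex.ofReal_tsum, Complex.ofReal_div, Complex.ofReal_cpow (Nat.cast_nonneg _),
      Complex.ofReal_natCast, Complex.ofReal_sub, Complex.ofReal_one, Nat.totient_one,
      Nat.cast_one, inv_one, sub_add_cancel, LSeries, LSeries.term, hres]
    refine tsum_congr fun n => ?_
    split_ifs with hn
    · simp [hn]
    · rfl
  have hcont : ContinuousOn
      (fun x : ℝ => (LFunctionResidueClassAux (1 : ZMod 1) x).re) (Set.Ici 1) :=
    (Complex.continuous_re.continuousOn.comp (t := Set.univ)
      (continuousOn_LFunctionResidueClassAux (1 : ZMod 1)) fun _ _ => trivial).comp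
      Complex.continuous_ofReal.continuousOn fun x hx => by simpa using hx
  have hlim := ((hcont 1 Set.self_mem_Ici).mono_left (nhdsWithin_mono 1 Set.Ioi_subset_Ici_self))
  have hsub : Tendsto (fun s : ℝ => s - 1) (𝓝[>] 1) (𝓝 0) :=
    tendsto_nhdsWithin_of_tendsto_nhds (by simpa using (continuous_sub_right (1 : ℝ)).tendsto 1)
  have key := (hsub.mul hlim).add_const 1
  rw [zero_mul, zero_add] at key
  refine key.congr' ?_
  filter_upwards [self_mem_nhdsWithin] with s hs
  have hs0 : s - 1 ≠ 0 := (sub_pos.2 hs).ne'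
  rw [H hs]
  field_simp

theorem upperLogDirichletDensity_le_one (P : Set Nat.Primes) :
    upperLogDirichletDensity P ≤ 1 := by
  have hlim := ENNReal.tendsto_ofReal tendsto_sub_one_mul_tsum_vonMangoldt
  rw [ENNReal.ofReal_one] at hlim
  rw [← hlim.limsup_eq]
  refine limsup_le_limsup ?_
  filter_upwards [self_mem_nhdsWithin] with s hs
  have hs : 1 < s := hs
  have hnn : ∀ n : ℕ, 0 ≤ ArithmeticFunction.vonMangoldt n / (n : ℝ) ^ s := fun n =>
    div_nonneg ArithmeticFunction.vonMangoldt_nonneg (by positivity)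
  have hsum : Summable fun n : ℕ => ArithmeticFunction.vonMangoldt n / (n : ℝ) ^ s := by
    refine LSeries.summable_real_of_abscissaOfAbsConv_lt (lt_of_le_of_lt ?_
      (show (1 : EReal) < s from mod_cast hs))
    exact LSeries.abscissaOfAbsConv_le_of_forall_lt_LSeriesSummable fun y hy =>
      ArithmeticFunction.LSeriesSummable_vonMangoldt (by simpa using hy)
  rw [ENNReal.ofReal_mul (sub_pos.2 hs).le, ENNReal.ofReal_tsum_of_nonneg hnn hsum]
  gcongr
  have hinj : Function.Injective fun p : P => ((p : Nat.Primes) : ℕ) :=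
    Subtype.val_injective.comp Subtype.val_injective
  refine le_trans (le_of_eq (tsum_congr fun p => ?_)) (ENNReal.tsum_comp_le_tsum_of_injective hinj
    fun n : ℕ => ENNReal.ofReal (ArithmeticFunction.vonMangoldt n / (n : ℝ) ^ s))
  rw [ArithmeticFunction.vonMangoldt_apply_prime (p : Nat.Primes).2]

theorem upperLogDirichletDensity_eq_zero {P : Set Nat.Primes}
    (hP : ∑' p : P, ENNReal.ofReal
      (Real.log ((p : Nat.Primes) : ℕ) / (((p : Nat.Primes) : ℕ) : ℝ)) ≠ ⊤) :
    upperLogDirichletDensity P = 0 := by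
  set B := ∑' p : P, ENNReal.ofReal
      (Real.log ((p : Nat.Primes) : ℕ) / (((p : Nat.Primes) : ℕ) : ℝ))
  have hsub : Tendsto (fun s : ℝ => s - 1) (𝓝[>] 1) (𝓝 0) :=
    tendsto_nhdsWithin_of_tendsto_nhds (by simpa using (continuous_sub_right (1 : ℝ)).tendsto 1)
  have hlim : Tendsto (fun s : ℝ => ENNReal.ofReal (s - 1) * B) (𝓝[>] 1) (𝓝 0) := by
    have := ENNReal.Tendsto.mul_const (b := B) (ENNReal.tendsto_ofReal hsub) (Or.inr hP)
    simpa using this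
  refine le_antisymm ?_ zero_le
  rw [← hlim.limsup_eq]
  refine limsup_le_limsup ?_
  filter_upwards [self_mem_nhdsWithin] with s hs
  refine mul_le_mul_right (ENNReal.tsum_le_tsum fun p => ENNReal.ofReal_le_ofReal ?_) _
  have h1 : (1 : ℝ) ≤ ((p : Nat.Primes) : ℕ) := mod_cast (p : Nat.Primes).2.one_lt.le
  refine div_le_div_of_nonneg_left (Real.log_nonneg h1) (by linarith) ?_
  exact Real.self_le_rpow_of_one_le h1 (le_of_lt hs)

open Classical in
/-- The sum of `log p` over the primes dividing `m` is at most `log |m|`. -/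
theorem tsum_log_primes_dvd_le {m : ℤ} (hm : m ≠ 0) :
    ∑' p : Nat.Primes, (if ((p : ℕ) : ℤ) ∣ m then ENNReal.ofReal (Real.log (p : ℕ)) else 0) ≤
      ENNReal.ofReal (Real.log m.natAbs) := by
  have hm' : m.natAbs ≠ 0 := Int.natAbs_ne_zero.2 hm
  have h1 := ENNReal.tsum_comp_le_tsum_of_injective
    (f := fun p : Nat.Primes => (p : ℕ)) Subtype.val_injective
    fun q => if q ∈ m.natAbs.primeFactors then ENNReal.ofReal (Real.log q) else 0
  have h2 : ∀ p : Nat.Primes, (p : ℕ) ∈ m.natAbs.primeFactors ↔ ((p : ℕ) : ℤ) ∣ m := fun p => by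
    rw [Nat.mem_primeFactors, Int.natCast_dvd]
    exact ⟨fun h => h.2.1, fun h => ⟨p.2, h, hm'⟩⟩
  simp only [h2] at h1
  refine h1.trans ?_
  rw [tsum_eq_sum (s := m.natAbs.primeFactors) fun q hq => if_neg hq,
    Finset.sum_congr rfl fun q hq => if_pos hq, ← ENNReal.ofReal_sum_of_nonneg fun q _ =>
      Real.log_natCast_nonneg q]
  refine ENNReal.ofReal_le_ofReal ?_
  rw [← Real.log_prod fun q hq =>
    Nat.cast_ne_zero.2 (Nat.prime_of_mem_primeFactors hq).ne_zero, ← Nat.cast_prod]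
  have hdvd := Nat.prod_primeFactors_dvd m.natAbs
  exact Real.log_le_log (mod_cast Nat.pos_of_dvd_of_pos hdvd (Nat.pos_of_ne_zero hm'))
    (mod_cast Nat.le_of_dvd (Nat.pos_of_ne_zero hm') hdvd)

/-! ### Divisibility and size of `W_f` -/

variable {N : ℕ}

theorem W_ne_zero (f : LaurentPoly N) (Λ : FinSubgroup N) : W f Λ ≠ 0 := by
  classical
  intro h
  have h1 := W_spec f Λ
  rw [h, Int.cast_zero, prodValue, eq_comm, Finset.prod_eq_zero_iff] at h1
  obtain ⟨ζ, hζ, h0⟩ := h1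
  exact (Finset.mem_filter.1 hζ).2 h0

/-- Divisibility of rational integers may be tested in the ring of all algebraic integers. -/
theorem int_dvd_of_isIntegral {a b : ℤ} (ha : a ≠ 0) {c : QBar} (hc : IsIntegral ℤ c)
    (h : (b : QBar) = a * c) : a ∣ b := by
  have ha' : (a : QBar) ≠ 0 := Int.cast_ne_zero.2 ha
  have hq : algebraMap ℚ QBar ((b : ℚ) / a) = c := by
    rw [map_div₀, map_intCast, map_intCast, h, mul_div_cancel_left₀ _ ha']
  rw [← hq] at hc
  obtain ⟨n, hn⟩ := IsIntegrallyClosed.isIntegral_iff.1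
    ((isIntegral_algebraMap_iff (algebraMap ℚ QBar).injective).1 hc)
  refine ⟨n, ?_⟩
  rw [← hq, ← hn] at h
  simp only [eq_intCast, map_intCast] at h
  exact_mod_cast h

theorem W_dvd_W_of_le (f : LaurentPoly N) {Λ Λ' : FinSubgroup N} (h : Λ ≤ Λ') :
    W f Λ ∣ W f Λ' := by
  classical
  have hsub : (Λ.2.toFinset.filter fun ζ => eval f ζ ≠ 0) ⊆
      Λ'.2.toFinset.filter fun ζ => eval f ζ ≠ 0 :=
    Finset.filter_subset_filter _ (Set.Finite.toFinset_subset_toFinset.2 h)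
  refine int_dvd_of_isIntegral (W_ne_zero f Λ)
    (c := ∏ ζ ∈ (Λ'.2.toFinset.filter fun ζ => eval f ζ ≠ 0) \
      (Λ.2.toFinset.filter fun ζ => eval f ζ ≠ 0), eval f ζ) ?_ ?_
  · refine IsIntegral.prod _ fun ζ hζ => isIntegral_eval f Λ' ?_
    simpa using (Finset.mem_filter.1 (Finset.mem_sdiff.1 hζ).1).1
  · rw [W_spec, W_spec, prodValue, prodValue, mul_comm]
    exact (Finset.prod_sdiff hsub).symm

/-- The full `n`-torsion subgroup `μ_n^N` of the torus, for `n ≠ 0`. -/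
noncomputable def torsion (N n : ℕ) [NeZero n] : FinSubgroup N :=
  ⟨Subgroup.pi Set.univ fun _ => rootsOfUnity n QBar, by
    rw [Subgroup.coe_pi]
    exact Set.Finite.pi fun _ => 
      inferInstanceAs (Finite (rootsOfUnity n QBar))⟩

theorem mem_torsion {n : ℕ} [NeZero n] {ζ : Torus N} : ζ ∈ (torsion N n).1 ↔ ζ ^ n = 1 := by
  simp [torsion, Subgroup.mem_pi, funext_iff]

theorem size_torsion_le (N n : ℕ) [NeZero n] : (torsion N n).size ≤ n ^ N := by
  have hinj : Function.Injective
      fun (ζ : (torsion N n).1) (i : Fin N) =>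
        (⟨ζ.1 i, ζ.2 i trivial⟩ : rootsOfUnity n QBar) := by
    intro ζ ξ h
    ext i
    exact congrArg (fun u : rootsOfUnity n QBar => ((u : QBarˣ) : QBar)) (congrFun h i)
  refine (Nat.card_le_card_of_injective _ hinj).trans ?_
  rw [Nat.card_fun, Nat.card_fin]
  refine Nat.pow_le_pow_left ?_ N
  exact card_rootsOfUnity QBar n

theorem le_torsion_size (Λ : FinSubgroup N) [NeZero Λ.size] : Λ ≤ torsion N Λ.size := by
  intro ζ hζ
  refine mem_torsion.2 ?_
  exact congrArg Subtype.val (pow_card_eq_one' (x := (⟨ζ, hζ⟩ : Λ.1)))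

theorem size_pos (Λ : FinSubgroup N) : 0 < Λ.size := by
  have : Finite Λ.1 := Λ.2
  exact Nat.card_pos

/-- In every complex embedding, a value of `f` at a torsion point is bounded by the sum of the
absolute values of the coefficients of `f`. -/
theorem norm_eval_le (f : LaurentPoly N) (σ : QBar →+* ℂ) (Λ : FinSubgroup N) {ζ : Torus N}
    (hζ : ζ ∈ Λ.1) : ‖σ (eval f ζ)‖ ≤ f.coeff.sum fun _ a => |(a : ℝ)| := by
  have h1 : ∀ i, ‖σ (ζ i : QBar)‖ = 1 := fun i => by
    refine Complex.norm_eq_one_of_pow_eq_one (n := Λ.size) ?_ (size_pos Λ).ne'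
    have h2 : ζ ^ Λ.size = 1 := congrArg Subtype.val (pow_card_eq_one' (x := (⟨ζ, hζ⟩ : Λ.1)))
    rw [← map_pow, ← Units.val_pow_eq_pow_val, ← Pi.pow_apply, h2]
    simp
  unfold eval Finsupp.sum
  rw [map_sum]
  refine (norm_sum_le _ _).trans (Finset.sum_le_sum fun m _ => ?_)
  simp [Units.coe_prod, Units.val_zpow_eq_zpow_val, map_prod, map_zpow₀, h1]

theorem exists_log_natAbs_W_torsion_le (f : LaurentPoly N) :
    ∃ C : ℝ, 0 ≤ C ∧ ∀ (n : ℕ) [NeZero n],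
      Real.log (W f (torsion N n)).natAbs ≤ C * (n : ℝ) ^ N := by
  classical
  obtain ⟨σ⟩ : Nonempty (QBar →+* ℂ) := by
    -- The `ℚ`-algebra structure for which `QBar` is known to be algebraic is not the one that
    -- comes from its being a field of characteristic zero.
    let : Algebra ℚ QBar := AlgebraicClosure.instAlgebra ℚ
    have : Algebra.IsAlgebraic ℚ QBar := AlgebraicClosure.isAlgebraic ℚ
    exact ⟨(IsAlgClosed.lift : QBar →ₐ[ℚ] ℂ).toRingHom⟩
  set S : ℝ := f.coeff.sum fun _ a => |(a : ℝ)|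
  have hS : 0 ≤ S := Finset.sum_nonneg fun _ _ => abs_nonneg _
  -- The summand `1` makes the logarithm nonnegative and `x ↦ (1 + S) ^ x` monotone.
  refine ⟨Real.log (1 + S), Real.log_nonneg (by linarith), fun n _ => ?_⟩
  set F := (torsion N n).2.toFinset.filter fun ζ => eval f ζ ≠ 0
  have hF : F.card ≤ n ^ N := by
    refine (Finset.card_filter_le _ _).trans (le_trans (le_of_eq ?_) (size_torsion_le N n))
    exact (Set.ncard_eq_toFinset_card _ (torsion N n).2).symm
  have hW : ((W f (torsion N n)).natAbs : ℝ) = ∏ ζ ∈ F, ‖σ (eval f ζ)‖ := by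
    rw [← norm_prod, ← map_prod]
    change _ = ‖σ (prodValue f (torsion N n))‖
    rw [← W_spec, map_intCast, Complex.norm_intCast, Nat.cast_natAbs, Int.cast_abs]
  have hle : ((W f (torsion N n)).natAbs : ℝ) ≤ (1 + S) ^ (n ^ N) := by
    rw [hW]
    refine le_trans (Finset.prod_le_prod (g := fun _ => 1 + S) (fun ζ _ => norm_nonneg _)
      fun ζ hζ => ?_)
      ((Finset.prod_const _).trans_le (pow_le_pow_right₀ (by linarith) hF))
    refine (norm_eval_le f σ (torsion N n) ?_).trans (le_add_of_nonneg_left zero_le_one)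
    simpa using (Finset.mem_filter.1 hζ).1
  refine (Real.log_le_log ?_ hle).trans (le_of_eq ?_)
  · exact mod_cast Int.natAbs_pos.2 (W_ne_zero f _)
  · rw [Real.log_pow, mul_comm]
    push_cast
    rfl

/-! ### Primes with a small rank of apparition -/

/-- Every prime of `P_f(θ)` divides `W_f(μ_n^N)` for some `n = k + 1 ≤ p ^ θ`. -/
theorem exists_dvd_W_torsion {f : LaurentPoly N} {θ : ℝ} {p : Nat.Primes}
    (hp : p ∈ smallRankPrimes f θ) :
    ∃ k : ℕ, ((k + 1 : ℕ) : ℝ) ≤ ((p : ℕ) : ℝ) ^ θ ∧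
      ((p : ℕ) : ℤ) ∣ W f (torsion N (k + 1)) := by
  obtain ⟨Λ, ⟨hdvd, -⟩, hle⟩ := hp
  obtain ⟨k, hk⟩ := Nat.exists_eq_succ_of_ne_zero (size_pos Λ).ne'
  have : NeZero Λ.size := ⟨(size_pos Λ).ne'⟩
  refine ⟨k, by rwa [hk] at hle, ?_⟩
  have h := hdvd.trans (W_dvd_W_of_le f (le_torsion_size Λ))
  simpa only [hk] using h

theorem tsum_smallRankPrimes_ne_top (f : LaurentPoly N) {θ : ℝ} (hθ : 0 < θ)
    (h : ((N : ℝ) + 1) * θ < 1) :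
    ∑' p : smallRankPrimes f θ, ENNReal.ofReal
      (Real.log ((p : Nat.Primes) : ℕ) / (((p : Nat.Primes) : ℕ) : ℝ)) ≠ ⊤ := by
  classical
  obtain ⟨C, hC, hW⟩ := exists_log_natAbs_W_torsion_le f
  have hexp : (N : ℝ) - θ⁻¹ < -1 := by
    have : (N : ℝ) + 1 < θ⁻¹ := (lt_inv_mul_iff₀' hθ).2 h |>.trans_eq (mul_one _)
    linarith
  have hsum : Summable fun k : ℕ => C * ((k + 1 : ℕ) : ℝ) ^ ((N : ℝ) - θ⁻¹) :=
    (((summable_nat_add_iff 1).2 (Real.summable_nat_rpow.2 hexp))).mul_left C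
  refine ne_top_of_le_ne_top hsum.tsum_ofReal_ne_top ?_
  -- Every prime `p` is charged to all `n = k + 1 ≤ p ^ θ` with `p ∣ W_f(μ_n^N)`; for such `n`
  -- one has `1 / p ≤ n ^ (-1 / θ)`.
  calc ∑' p : smallRankPrimes f θ, ENNReal.ofReal
        (Real.log ((p : Nat.Primes) : ℕ) / (((p : Nat.Primes) : ℕ) : ℝ))
      ≤ ∑' p : smallRankPrimes f θ, ∑' k : ℕ,
          ENNReal.ofReal (((k + 1 : ℕ) : ℝ) ^ (-θ⁻¹)) *
            (if (((p : Nat.Primes) : ℕ) : ℤ) ∣ W f (torsion N (k + 1)) then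
              ENNReal.ofReal (Real.log ((p : Nat.Primes) : ℕ)) else 0) := by
        refine ENNReal.tsum_le_tsum fun p => ?_
        obtain ⟨k, hk, hdvd⟩ := exists_dvd_W_torsion p.2
        refine le_trans ?_ (ENNReal.le_tsum k)
        have hp0 : (0 : ℝ) < (((p : Nat.Primes) : ℕ) : ℝ) := mod_cast (p : Nat.Primes).2.pos
        rw [if_pos hdvd, ← ENNReal.ofReal_mul (by positivity), div_eq_inv_mul]
        refine ENNReal.ofReal_le_ofReal
          (mul_le_mul_of_nonneg_right ?_ (Real.log_natCast_nonneg _))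
        rw [Real.rpow_neg (by positivity)]
        refine inv_anti₀ (by positivity) ?_
        calc ((k + 1 : ℕ) : ℝ) ^ θ⁻¹
            ≤ ((((p : Nat.Primes) : ℕ) : ℝ) ^ θ) ^ θ⁻¹ :=
              Real.rpow_le_rpow (by positivity) hk (by positivity)
          _ = _ := Real.rpow_rpow_inv hp0.le hθ.ne'
    _ ≤ ∑' p : Nat.Primes, ∑' k : ℕ, ENNReal.ofReal (((k + 1 : ℕ) : ℝ) ^ (-θ⁻¹)) *
            (if ((p : ℕ) : ℤ) ∣ W f (torsion N (k + 1)) then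
              ENNReal.ofReal (Real.log (p : ℕ)) else 0) :=
        ENNReal.tsum_comp_le_tsum_of_injective Subtype.val_injective _
    _ = ∑' k : ℕ, ENNReal.ofReal (((k + 1 : ℕ) : ℝ) ^ (-θ⁻¹)) * ∑' p : Nat.Primes,
            (if ((p : ℕ) : ℤ) ∣ W f (torsion N (k + 1)) then
              ENNReal.ofReal (Real.log (p : ℕ)) else 0) := by
        rw [ENNReal.tsum_comm]
        exact tsum_congr fun k => ENNReal.tsum_mul_left
    _ ≤ ∑' k : ℕ, ENNReal.ofReal (C * ((k + 1 : ℕ) : ℝ) ^ ((N : ℝ) - θ⁻¹)) := by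
        refine ENNReal.tsum_le_tsum fun k => ?_
        refine (mul_le_mul_right ((tsum_log_primes_dvd_le (W_ne_zero f _)).trans
          (ENNReal.ofReal_le_ofReal (hW (k + 1)))) _).trans (le_of_eq ?_)
        rw [← ENNReal.ofReal_mul (by positivity), sub_eq_add_neg,
          Real.rpow_add (by positivity), Real.rpow_natCast]
        congr 1
        ring

end DDSeq

theorem corollary7p4 (N : ℕ) (hN : 0 < N) (f : DDSeq.LaurentPoly N) (hf : f ≠ 0)
    (θ : ℝ) (hθ : 0 < θ) :
    DDSeq.upperLogDirichletDensity (DDSeq.smallRankPrimes f θ) ≤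
      ENNReal.ofReal (((N : ℝ) + 1) * θ) := by
  rcases lt_or_ge (((N : ℝ) + 1) * θ) 1 with h | h
  · rw [DDSeq.upperLogDirichletDensity_eq_zero (DDSeq.tsum_smallRankPrimes_ne_top f hθ h)]
    exact zero_le
  · exact (DDSeq.upperLogDirichletDensity_le_one _).trans (by simpa using h)
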